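/- Let $I$ be a finite set of indivisible goods. A (single-unit) valuation is a function $V:X\to\mathbb{R}$ on a nonempty set $X\subseteq\{0,1\}^I$ of feasible consumption vectors ($X$ may depend on $V$); an agent with valuation $V$ has utility $x_0+V(x)$ from an amount $x_0\in\mathbb{R}$ of money and $x\in X$, and demand $D_V(p)=\operatorname{argmax}_{x\in X}\{V(x)-p\cdot x\}$ at prices $p\in\mathbb{R}^I$. An economy consists of finitely many agents $j$ with valuations $V^j:X^j\to\mathbb{R}$, endowments of money, and endowments $w^j\in X^j$ of goods; a competitive equilibrium consists of a price vector $p\in\mathbb{R}^I$ and $x^j\in D_{V^j}(p)$ for each $j$ with $\sum_j x^j=\sum_j w^j$. A set $\mathcal{V}$ of valuations is an invariant domain if it contains the zero valuation $\{0,1\}^I\to\mathbb{R}$ and if, for all $V\in\mathcal{V}$ with feasible set $X$ and all $p\in\mathbb{R}_{\ge0}^I$, the valuation $x\mapsto V(x)+p\cdot x$ on $X$ belongs to $\mathcal{V}$. A price effect for $V$ is a nonzero vector $\Delta$ for which there are a good $i$, a price vector $p$ with $D_V(p)=\{x\}$ for some $x$, and a price vector $p'$ obtained from $p$ by lowering the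 price of $i$ only, with $x+\Delta\in D_V(p')$. A bundle $b\in\{-1,0,1\}^I$ is relevant (for $\mathcal{V}$) if it is a price effect for some $V\in\mathcal{V}$ or a unit vector $e_i$, $i\in I$. A bundling is a set $B\subseteq\{-1,0,1\}^I$ that is a basis of $\mathbb{R}^I$. For $V:X\to\mathbb{R}$ and $t\in\mathbb{R}^B$, the bundled demand $\widetilde D_V(t;B)$ is the set of maximizers of $V(\sum_{b\in B}q_b b)-t\cdot q$ over all $q\in\mathbb{R}^B$ with $\sum_{b\in B}q_b b\in X$. For $b,c\in B$, the bundle $b$ is substitutable (resp. complementary) to $c$ if for all $V\in\mathcal{V}$, all $t\in\mathbb{R}^B$ with $\widetilde D_V(t;B)=\{q\}$, and all $t'$ obtained from $t$ by lowering the price of $b$ only, there is $q'\in\widetilde D_V(t';B)$ with $q'_c\le q_c$ (resp. $q'_c\ge q_c$); $b$ is consistent with $c$ if $c$ is substitutable to $b$ or complementary to $b$. The valuations in $\mathcal{V}$ are bundle-consistent if for every bundling $B$ consisting only of relevant bundles, all $b,c\in B$ are consistent. Theorem. Let $\mathcal{V}$ be an invariant domain of single-unit valuations. If every economy in which all agents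 have valuations in $\mathcal{V}$ has a competitive equilibrium, then the valuations in $\mathcal{V}$ are bundle-consistent. -/

import Mathlib

open scoped BigOperators

/-- A valuation in the single-unit setting, over a set `I` of indivisible goods: a nonempty set
`dom` (written `X`) of feasible consumption vectors contained in `{0,1}^I`, and a real-valued
function on it. Consumption vectors are regarded as elements of `ℝ^I`. -/
structure SingleUnitValuation (I : Type*) where
  dom : Set (I → ℝ)
  dom_nonempty : dom.Nonempty
  dom_binary : ∀ x ∈ dom, ∀ i, x i = 0 ∨ x i = 1
  val : dom → ℝ

/-- `p'` arises from the price vector `p` by lowering the price of `i` only. -/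
def IsPriceFall {K : Type*} (i : K) (p p' : K → ℝ) : Prop :=
  p' i < p i ∧ ∀ k, k ≠ i → p' k = p k

/-- A bundling: a set of vectors in `{-1,0,1}^I` that forms a basis of `ℝ^I`. -/
structure IsBundling {I : Type*} (B : Finset (I → ℝ)) : Prop where
  entries : ∀ b ∈ B, ∀ i, b i = -1 ∨ b i = 0 ∨ b i = 1
  linearIndependent : LinearIndependent ℝ (fun b : B => (b : I → ℝ))
  span_eq_top : Submodule.span ℝ (B : Set (I → ℝ)) = ⊤

/-- The consumption vector `∑_{b ∈ B} q_b b` that corresponds to a (possibly fractional or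
negative) quantity vector `q ∈ ℝ^B` of bundles. -/
def bundleVector {I : Type*} (B : Finset (I → ℝ)) (q : B → ℝ) : I → ℝ :=
  ∑ b : B, q b • (b : I → ℝ)

namespace SingleUnitValuation

variable {I : Type*}

/-- The quasilinear utility `x₀ + V(x)`. -/
def utility (V : SingleUnitValuation I) (x₀ : ℝ) (x : V.dom) : ℝ := x₀ + V.val x

/-- The valuation `V₀` that is defined on all of `{0,1}^I` and vanishes identically. -/
def zero (I : Type*) : SingleUnitValuation I where
  dom := {x | ∀ i, x i = 0 ∨ x i = 1}
  dom_nonempty := ⟨0, fun _ => Or.inl rfl⟩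
  dom_binary := fun _ hx => hx
  val := fun _ => 0

variable [Fintype I]

/-- The valuation `V'(x) = V(x) + p · x`, on the same feasible set as `V`. -/
def addLinear (V : SingleUnitValuation I) (p : I → ℝ) : SingleUnitValuation I where
  dom := V.dom
  dom_nonempty := V.dom_nonempty
  dom_binary := V.dom_binary
  val := fun x => V.val x + p ⬝ᵥ (x : I → ℝ)

/-- Demand `D(p)`: the maximizers of `V(x) - p · x` over the feasible set. -/
def demand (V : SingleUnitValuation I) (p : I → ℝ) : Set (I → ℝ) :=
  {x | ∃ hx : x ∈ V.dom, ∀ (y : I → ℝ) (hy : y ∈ V.dom),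
    V.val ⟨y, hy⟩ - p ⬝ᵥ y ≤ V.val ⟨x, hx⟩ - p ⬝ᵥ x}

/-- `Δ` is a price effect for the good `i`. -/
def IsPriceEffect (V : SingleUnitValuation I) (i : I) (Δ : I → ℝ) : Prop :=
  Δ ≠ 0 ∧ ∃ p p' x : I → ℝ,
    IsPriceFall i p p' ∧ V.demand p = {x} ∧ x + Δ ∈ V.demand p'

/-- Bundled demand at the bundle price vector `t ∈ ℝ^B`: the maximizers of `V(x(q;B)) - t · q`
over all quantity vectors `q ∈ ℝ^B` whose consumption vector `x(q;B)` is feasible. -/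
def bundledDemand (V : SingleUnitValuation I) (B : Finset (I → ℝ)) (t : B → ℝ) : Set (B → ℝ) :=
  {q | ∃ hq : bundleVector B q ∈ V.dom, ∀ (r : B → ℝ) (hr : bundleVector B r ∈ V.dom),
    V.val ⟨bundleVector B r, hr⟩ - t ⬝ᵥ r ≤ V.val ⟨bundleVector B q, hq⟩ - t ⬝ᵥ q}

end SingleUnitValuation

/-- Bundle `b` is substitutable to bundle `c`: a fall in the price of `b` weakly lowers the
demand for `c`, for all agents with valuations in `𝒱`. -/
def IsSubstitutable {I : Type*} (𝒱 : Set (SingleUnitValuation I))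
    (B : Finset (I → ℝ)) (b c : B) : Prop :=
  ∀ V ∈ 𝒱, ∀ t t' q : B → ℝ, V.bundledDemand B t = {q} → IsPriceFall b t t' →
    ∃ q' ∈ V.bundledDemand B t', q' c ≤ q c

/-- Bundle `b` is complementary to bundle `c`: a fall in the price of `b` weakly raises the
demand for `c`, for all agents with valuations in `𝒱`. -/
def IsComplementary {I : Type*} (𝒱 : Set (SingleUnitValuation I))
    (B : Finset (I → ℝ)) (b c : B) : Prop :=
  ∀ V ∈ 𝒱, ∀ t t' q : B → ℝ, V.bundledDemand B t = {q} → IsPriceFall b t t' →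
    ∃ q' ∈ V.bundledDemand B t', q c ≤ q' c

/-- Bundle `b` is consistent with bundle `c`. -/
def IsConsistent {I : Type*} (𝒱 : Set (SingleUnitValuation I))
    (B : Finset (I → ℝ)) (b c : B) : Prop :=
  IsSubstitutable 𝒱 B c b ∨ IsComplementary 𝒱 B c b

/-- A relevant bundle: a vector in `{-1,0,1}^I` that is a price effect for some valuation in `𝒱`
or the bundle that consists of one unit of a single good. -/
def IsRelevant {I : Type*} [Fintype I] [DecidableEq I] (𝒱 : Set (SingleUnitValuation I))
    (b : I → ℝ) : Prop :=
  (∀ i, b i = -1 ∨ b i = 0 ∨ b i = 1) ∧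
    ((∃ V ∈ 𝒱, ∃ i, V.IsPriceEffect i b) ∨ ∃ i, b = Pi.single i 1)

/-- The valuations in `𝒱` are bundle-consistent. -/
def BundleConsistent {I : Type*} [Fintype I] [DecidableEq I]
    (𝒱 : Set (SingleUnitValuation I)) : Prop :=
  ∀ B : Finset (I → ℝ), IsBundling B → (∀ b ∈ B, IsRelevant 𝒱 b) →
    ∀ b c : B, IsConsistent 𝒱 B b c

/-- An invariant domain of valuations. -/
structure IsInvariantDomain {I : Type*} [Fintype I] (𝒱 : Set (SingleUnitValuation I)) : Prop where
  addLinear_mem : ∀ V ∈ 𝒱, ∀ p : I → ℝ, (∀ i, 0 ≤ p i) → V.addLinear p ∈ 𝒱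
  zero_mem : SingleUnitValuation.zero I ∈ 𝒱

/-- A transferable utility economy with goods `I` and agents `J`: each agent has a valuation, an
endowment of money and a feasible endowment of goods. -/
structure Economy (I J : Type*) where
  valuation : J → SingleUnitValuation I
  money : J → ℝ
  goods : (j : J) → (valuation j).dom

/-- The price vector `p` and the consumption vectors `x` form a competitive equilibrium: each
agent maximizes utility subject to the budget constraint, and the markets for goods clear. -/
structure Economy.IsEquilibrium {I J : Type*} [Fintype I] [Fintype J] (E : Economy I J)
    (p : I → ℝ) (x : (j : J) → (E.valuation j).dom) : Prop where
  optimal : ∀ (j : J) (y : (E.valuation j).dom),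
    (E.valuation j).utility
        (E.money j - p ⬝ᵥ ((y : I → ℝ) - (E.goods j : I → ℝ))) y ≤
      (E.valuation j).utility
        (E.money j - p ⬝ᵥ ((x j : I → ℝ) - (E.goods j : I → ℝ))) (x j)
  clearing : ∑ j, (x j : I → ℝ) = ∑ j, (E.goods j : I → ℝ)

/-! Equilibria force integrality: if convex combinations of demanded bundles have an integral sum,
that sum is also a sum of demanded bundles, because an equilibrium of a suitable economy is
supported by the original prices (`exists_demand_sum_eq_of_integral`). A relevant bundle `b` is the
difference of a demand set `{x, x + b}`, so an extra agent can contribute any fraction of it,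
rounded to zero or one unit (`exists_rounding`). Hence a bundling of relevant bundles is unimodular,
and coordinates already integral survive rounding while the others are topped up freely
(`exists_int_dot`, `exists_demand_dot_eq`). If consistency fails, a cut in the price of `c` raises
the demand for `b` under one valuation and lowers it under another. Each yields a demand set on a
line of slope `1`, respectively `-1`, in the `(b, c)` plane, with two points one unit apart
(`exists_demand_line`, `exists_demand_unit_line`). The sum of the two midpoints has integral `b` and
`c` coordinates, yet on these lines no pair of demanded bundles attains it, by parity. -/

open Filter Topology

/-! ### Demand sets and price perturbations. -/

namespace SingleUnitValuation

variable {I : Type*}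

open Classical in
/-- The valuation, extended by zero to infeasible consumption vectors. -/
noncomputable def extend (V : SingleUnitValuation I) (x : I → ℝ) : ℝ :=
  if h : x ∈ V.dom then V.val ⟨x, h⟩ else 0

lemma extend_of_mem (V : SingleUnitValuation I) {x : I → ℝ} (h : x ∈ V.dom) :
    V.extend x = V.val ⟨x, h⟩ := dif_pos h

lemma dom_finite [Finite I] (V : SingleUnitValuation I) : V.dom.Finite :=
  (Set.Finite.pi' (fun _ : I => Set.toFinite {(0 : ℝ), 1})).subset
    fun x hx i => by simpa using V.dom_binary x hx i

variable [Fintype I]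

/-- The net payoff from the consumption vector `x` at prices `p`. -/
noncomputable def surplus (V : SingleUnitValuation I) (p x : I → ℝ) : ℝ := V.extend x - p ⬝ᵥ x

lemma mem_demand {V : SingleUnitValuation I} {p x : I → ℝ} :
    x ∈ V.demand p ↔ x ∈ V.dom ∧ ∀ y ∈ V.dom, V.surplus p y ≤ V.surplus p x := by
  constructor
  · rintro ⟨hx, h⟩
    refine ⟨hx, fun y hy => ?_⟩
    simpa [surplus, extend_of_mem, hx, hy] using h y hy
  · rintro ⟨hx, h⟩
    refine ⟨hx, fun y hy => ?_⟩
    simpa [surplus, extend_of_mem, hx, hy] using h y hy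

lemma demand_subset_dom (V : SingleUnitValuation I) (p : I → ℝ) : V.demand p ⊆ V.dom :=
  fun _ hx => (mem_demand.1 hx).1

lemma demand_nonempty (V : SingleUnitValuation I) (p : I → ℝ) : (V.demand p).Nonempty := by
  obtain ⟨x, hx, h⟩ := Set.exists_max_image V.dom (V.surplus p) V.dom_finite V.dom_nonempty
  exact ⟨x, mem_demand.2 ⟨hx, h⟩⟩

lemma surplus_eq_of_mem {V : SingleUnitValuation I} {p x y : I → ℝ}
    (hx : x ∈ V.demand p) (hy : y ∈ V.demand p) : V.surplus p x = V.surplus p y :=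
  le_antisymm ((mem_demand.1 hy).2 x (mem_demand.1 hx).1) ((mem_demand.1 hx).2 y (mem_demand.1 hy).1)

lemma mem_demand_of_le {V : SingleUnitValuation I} {p x y : I → ℝ}
    (hx : x ∈ V.demand p) (hy : y ∈ V.dom) (h : V.surplus p x ≤ V.surplus p y) : y ∈ V.demand p :=
  mem_demand.2 ⟨hy, fun z hz => ((mem_demand.1 hx).2 z hz).trans h⟩

lemma surplus_add_smul (V : SingleUnitValuation I) (p d x : I → ℝ) (ε : ℝ) :
    V.surplus (p + ε • d) x = V.surplus p x - ε * (d ⬝ᵥ x) := by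
  simp only [surplus, add_dotProduct, smul_dotProduct, smul_eq_mul]; ring

/-- Through this shift, agents observed at different prices can be placed at one common price
vector. -/
lemma demand_addLinear (V : SingleUnitValuation I) (r p : I → ℝ) :
    (V.addLinear r).demand p = V.demand (p - r) := by
  ext x
  have key : ∀ y ∈ V.dom, (V.addLinear r).surplus p y = V.surplus (p - r) y := by
    intro y hy
    have hy' : y ∈ (V.addLinear r).dom := hy
    rw [surplus, surplus, extend_of_mem _ hy, extend_of_mem _ hy', sub_dotProduct]
    simp only [addLinear]
    ring
  rw [mem_demand, mem_demand]
  refine and_congr_right fun hx => forall₂_congr fun y hy => ?_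
  rw [key x hx, key y hy]

/-- A small perturbation of prices in the direction `d` selects the `d`-cheapest bundles among those
demanded before the perturbation. -/
lemma eventually_demand_add_smul (V : SingleUnitValuation I) (p d : I → ℝ) :
    ∀ᶠ ε in 𝓝[>] (0 : ℝ), V.demand (p + ε • d) =
      {x | x ∈ V.demand p ∧ ∀ y ∈ V.demand p, d ⬝ᵥ x ≤ d ⬝ᵥ y} := by
  -- Strict comparisons at `p`, finite in number, survive a small `ε`; only ties at `p` are left for
  -- `d` to break.
  have h1 : ∀ x ∈ V.dom, ∀ y ∈ V.dom, ∀ᶠ ε in 𝓝[>] (0 : ℝ),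
      V.surplus p x < V.surplus p y → V.surplus (p + ε • d) x < V.surplus (p + ε • d) y := by
    intro x _ y _
    by_cases hxy : V.surplus p x < V.surplus p y
    · have hx : Continuous fun ε : ℝ => V.surplus p x - ε * (d ⬝ᵥ x) := by fun_prop
      have hy : Continuous fun ε : ℝ => V.surplus p y - ε * (d ⬝ᵥ y) := by fun_prop
      have := (hx.tendsto 0).eventually_lt (hy.tendsto 0) (by simpa using hxy)
      filter_upwards [this.filter_mono nhdsWithin_le_nhds] with ε hε _
      simpa [surplus_add_smul] using hε
    · exact Eventually.of_forall fun _ h => absurd h hxy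
  have h2 : ∀ᶠ ε in 𝓝[>] (0 : ℝ), ∀ x ∈ V.dom, ∀ y ∈ V.dom,
      V.surplus p x < V.surplus p y → V.surplus (p + ε • d) x < V.surplus (p + ε • d) y :=
    (eventually_all_finite V.dom_finite).2 fun x hx =>
      (eventually_all_finite V.dom_finite).2 fun y hy => h1 x hx y hy
  filter_upwards [h2, self_mem_nhdsWithin] with ε hε hpos
  have hpos : 0 < ε := hpos
  obtain ⟨z, hz⟩ := V.demand_nonempty p
  ext x
  constructor
  · intro hx
    have hxd := demand_subset_dom _ _ hx
    have hxp : x ∈ V.demand p := by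
      refine mem_demand_of_le hz hxd (not_lt.1 fun h => ?_)
      have := hε x hxd z (demand_subset_dom _ _ hz) h
      exact absurd ((mem_demand.1 hx).2 z (demand_subset_dom _ _ hz)) (not_le.2 this)
    refine ⟨hxp, fun y hy => ?_⟩
    have h := (mem_demand.1 hx).2 y (demand_subset_dom _ _ hy)
    rw [surplus_add_smul, surplus_add_smul, surplus_eq_of_mem hxp hy] at h
    exact le_of_mul_le_mul_left (by linarith) hpos
  · rintro ⟨hx, h⟩
    have hxd := demand_subset_dom _ _ hx
    refine mem_demand.2 ⟨hxd, fun y hy => ?_⟩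
    by_cases hyp : y ∈ V.demand p
    · rw [surplus_add_smul, surplus_add_smul, surplus_eq_of_mem hx hyp]
      have := mul_le_mul_of_nonneg_left (h y hyp) hpos.le
      linarith
    · refine (hε y hy x hxd (not_le.1 fun hle => hyp ?_)).le
      exact mem_demand_of_le hx hy hle

/-- If lowering prices in the direction `g` strictly raises the demand for `f`, then at some prices
the demand set lies on a line along which `f` and `g` move in the same direction. -/
lemma exists_demand_line (V : SingleUnitValuation I) {p x₀ f g : I → ℝ} {δ : ℝ} (hδ : 0 < δ)
    (hx₀ : x₀ ∈ V.demand p) (hf : ∀ x ∈ V.demand (p + δ • -g), f ⬝ᵥ x₀ < f ⬝ᵥ x) :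
    ∃ (p' : I → ℝ) (l : ℝ), 0 < l ∧ ∃ u ∈ V.demand p', ∃ v ∈ V.demand p',
      f ⬝ᵥ u < f ⬝ᵥ v ∧ ∀ w ∈ V.demand p', g ⬝ᵥ w - g ⬝ᵥ u = l * (f ⬝ᵥ w - f ⬝ᵥ u) := by
  -- The critical prices are those at the last `s` where a bundle with `f` at most `f ⬝ᵥ x₀` is
  -- still demanded.
  set S : Set ℝ := {s | s ∈ Set.Icc 0 δ ∧ ∃ u ∈ V.demand (p + s • -g), f ⬝ᵥ u ≤ f ⬝ᵥ x₀} with hS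
  have hSeq : S = Set.Icc 0 δ ∩ ⋃ u ∈ {u | u ∈ V.dom ∧ f ⬝ᵥ u ≤ f ⬝ᵥ x₀}, ⋂ y ∈ V.dom,
      {s | V.surplus p y - s * (-g ⬝ᵥ y) ≤ V.surplus p u - s * (-g ⬝ᵥ u)} := by
    ext s
    simp only [hS, mem_demand, surplus_add_smul, Set.mem_ofPred_eq, Set.mem_inter_iff,
      Set.mem_iUnion, Set.mem_iInter, exists_prop]
    refine and_congr_right fun _ => exists_congr fun u => ?_
    tauto
  have hcomp : IsCompact S := by
    rw [hSeq]
    refine isCompact_Icc.inter_right ?_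
    refine (V.dom_finite.subset fun u hu => hu.1).isClosed_biUnion fun u _ => ?_
    refine isClosed_biInter fun y _ => isClosed_le ?_ ?_ <;> fun_prop
  obtain ⟨s, ⟨⟨hs0, hsδ⟩, u₀, hu₀, hfu₀⟩, hmax⟩ := hcomp.exists_isGreatest
    ⟨0, ⟨⟨le_rfl, hδ.le⟩, x₀, by simpa using hx₀, le_rfl⟩⟩
  have hlt : s < δ := lt_of_le_of_ne hsδ fun h => by
    subst h; exact absurd (hf u₀ hu₀) (not_lt.2 hfu₀)
  set P := V.demand (p + s • -g) with hP
  have hPfin : P.Finite := V.dom_finite.subset (demand_subset_dom _ _)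
  -- Just past `s` the `g`-maximizers of `P` are demanded, so a low one would contradict the
  -- maximality of `s`.
  have htop : ∀ x ∈ P, (∀ y ∈ P, g ⬝ᵥ y ≤ g ⬝ᵥ x) → f ⬝ᵥ x₀ < f ⬝ᵥ x := by
    intro x hx hxm
    have e1 := V.eventually_demand_add_smul (p + s • -g) (-g)
    have e2 : ∀ᶠ ε in 𝓝[>] (0 : ℝ), ε < δ - s :=
      (eventually_lt_nhds (sub_pos.2 hlt)).filter_mono nhdsWithin_le_nhds
    obtain ⟨ε, ⟨h1, h2⟩, h3⟩ := ((e1.and e2).and self_mem_nhdsWithin).exists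
    have h3 : 0 < ε := h3
    by_contra hcon
    have hmem : s + ε ∈ S := by
      refine ⟨⟨by linarith, by linarith⟩, x, ?_, not_lt.1 hcon⟩
      rw [add_smul, ← add_assoc, h1]
      refine ⟨hx, fun y hy => ?_⟩
      simpa [neg_dotProduct] using hxm y hy
    have := hmax hmem
    linarith
  obtain ⟨v₀, hv₀, hv₀max⟩ := Set.exists_max_image P (g ⬝ᵥ ·) hPfin ⟨u₀, hu₀⟩
  set lo := {x | x ∈ P ∧ f ⬝ᵥ x ≤ f ⬝ᵥ x₀} with hlo
  set hi := {x | x ∈ P ∧ f ⬝ᵥ x₀ < f ⬝ᵥ x} with hhi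
  have hv₀hi : v₀ ∈ hi := ⟨hv₀, htop v₀ hv₀ hv₀max⟩
  -- In the `(f, g)` plane, the edge of the upper hull of `P` that crosses from `lo` to `hi` is
  -- found by a min-max: the steepest slope from each `u` into `hi`, then the `u` in `lo` that makes
  -- it least.
  have hmaxslope : ∀ u, ∃ v ∈ hi, ∀ w ∈ hi, (g ⬝ᵥ w - g ⬝ᵥ u) / (f ⬝ᵥ w - f ⬝ᵥ u) ≤
      (g ⬝ᵥ v - g ⬝ᵥ u) / (f ⬝ᵥ v - f ⬝ᵥ u) := fun u =>
    Set.exists_max_image hi _ (hPfin.subset fun x hx => hx.1) ⟨v₀, hv₀hi⟩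
  choose m hm hmm using hmaxslope
  obtain ⟨u, hu, humin⟩ := Set.exists_min_image lo
    (fun u => (g ⬝ᵥ m u - g ⬝ᵥ u) / (f ⬝ᵥ m u - f ⬝ᵥ u))
    (hPfin.subset fun x hx => hx.1) ⟨u₀, hu₀, hfu₀⟩
  set l := (g ⬝ᵥ m u - g ⬝ᵥ u) / (f ⬝ᵥ m u - f ⬝ᵥ u) with hl
  have hd : ∀ a ∈ lo, ∀ b ∈ hi, 0 < f ⬝ᵥ b - f ⬝ᵥ a := fun a ha b hb => by
    have := ha.2; have := hb.2; linarith
  have hlpos : 0 < l := by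
    refine lt_of_lt_of_le (div_pos ?_ (hd u hu v₀ hv₀hi)) (hmm u v₀ hv₀hi)
    rw [sub_pos]
    by_contra hcon
    exact absurd (htop u hu.1 fun y hy => (hv₀max y hy).trans (not_lt.1 hcon)) (not_lt.2 hu.2)
  have hhile : ∀ w ∈ hi, g ⬝ᵥ w - l * (f ⬝ᵥ w) ≤ g ⬝ᵥ u - l * (f ⬝ᵥ u) := fun w hw => by
    have := (div_le_iff₀ (hd u hu w hw)).1 (hmm u w hw)
    rw [← hl] at this
    linarith
  have hmu : g ⬝ᵥ m u - l * (f ⬝ᵥ m u) = g ⬝ᵥ u - l * (f ⬝ᵥ u) := by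
    have := (div_eq_iff (hd u hu _ (hm u)).ne').1 hl.symm
    linarith
  have hle : ∀ w ∈ P, g ⬝ᵥ w - l * (f ⬝ᵥ w) ≤ g ⬝ᵥ u - l * (f ⬝ᵥ u) := by
    intro w hw
    by_cases hwlo : f ⬝ᵥ w ≤ f ⬝ᵥ x₀
    · refine le_trans ?_ (hhile (m w) (hm w))
      have h := humin w ⟨hw, hwlo⟩
      rw [le_div_iff₀ (hd w ⟨hw, hwlo⟩ _ (hm w))] at h
      linarith
    · exact hhile w ⟨hw, not_le.1 hwlo⟩
  -- This perturbation keeps exactly the maximizers of `g - l f` in `P`, that is, the bundles on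
  -- that edge.
  obtain ⟨ε, h1⟩ := (V.eventually_demand_add_smul (p + s • -g) (l • f - g)).exists
  have hdot : ∀ w, (l • f - g) ⬝ᵥ w = l * (f ⬝ᵥ w) - g ⬝ᵥ w := fun w => by
    simp [sub_dotProduct, smul_dotProduct]
  have hu' : u ∈ V.demand (p + s • -g + ε • (l • f - g)) := by
    rw [h1]
    refine ⟨hu.1, fun y hy => ?_⟩
    rw [hdot, hdot]
    linarith [hle y hy]
  refine ⟨_, l, hlpos, u, hu', m u, ?_, sub_pos.1 (hd u hu _ (hm u)), ?_⟩
  · rw [h1]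
    refine ⟨(hm u).1, fun y hy => ?_⟩
    rw [hdot, hdot]
    linarith [hle y hy]
  · intro w hw
    rw [h1] at hw hu'
    have a := hw.2 u hu.1
    have b := hu'.2 w hw.1
    rw [hdot, hdot] at a b
    linarith

/-! ### Demand sets with exactly one or two prescribed bundles. -/

lemma surplus_zero {x : I → ℝ} (hx : x ∈ (zero I).dom) (p : I → ℝ) :
    (zero I).surplus p x = -(p ⬝ᵥ x) := by
  rw [surplus, extend_of_mem _ hx]; simp [zero]

/-- A price effect is the difference between the two bundles of a two-element demand set. -/
lemma IsPriceEffect.exists_demand_eq_pair {V : SingleUnitValuation I} {i : I} {b : I → ℝ}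
    (h : V.IsPriceEffect i b) : ∃ p x, V.demand p = {x, x + b} := by
  classical
  obtain ⟨hb, p, p', x, ⟨hlt, heq⟩, hx, hz⟩ := h
  set z := x + b with hzdef
  have hzx : z ≠ x := fun h => hb (by simpa [hzdef] using h)
  have hxm : x ∈ V.demand p := by rw [hx]; rfl
  have hxd := demand_subset_dom _ _ hxm
  have hzd := demand_subset_dom _ _ hz
  have hstrict : ∀ y ∈ V.dom, y ≠ x → V.surplus p y < V.surplus p x := fun y hy hyx => by
    by_contra hcon
    have := mem_demand_of_le hxm hy (not_lt.1 hcon)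
    rw [hx] at this
    exact hyx this
  set δ := p i - p' i with hδ
  have hδpos : 0 < δ := sub_pos.2 hlt
  have hp' : p' = p + δ • -Pi.single i 1 := by
    ext k
    by_cases hk : k = i
    · subst hk; simp [hδ]
    · simp [hk, heq k hk]
  have hs : ∀ (s : ℝ) y, V.surplus (p + s • -Pi.single i 1) y = V.surplus p y + s * y i := by
    intro s y
    rw [surplus_add_smul, neg_dotProduct, single_dotProduct]; ring
  have hz' : ∀ y ∈ V.dom, V.surplus p y + δ * y i ≤ V.surplus p z + δ * z i := fun y hy => by
    have := (mem_demand.1 hz).2 y hy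
    rwa [hp', hs, hs] at this
  have hzi : x i = 0 ∧ z i = 1 := by
    have h1 := hz' x hxd
    have h2 := hstrict z hzd hzx
    have h3 : x i < z i := lt_of_mul_lt_mul_left (by linarith) hδpos.le
    rcases V.dom_binary x hxd i with h | h <;> rcases V.dom_binary z hzd i with h' | h' <;>
      rw [h, h'] at h3 <;> first | exact ⟨h, h'⟩ | (exfalso; linarith)
  -- The price cut for `i` at which `x` and `z` tie. There `x` is the only demanded bundle without
  -- good `i`.
  set γ := V.surplus p x - V.surplus p z with hγ
  have hxD : x ∈ V.demand (p + γ • -Pi.single i 1) := by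
    refine mem_demand.2 ⟨hxd, fun y hy => ?_⟩
    rw [hs, hs, hzi.1]
    rcases V.dom_binary y hy i with h | h
    · rw [h]; linarith [(mem_demand.1 hxm).2 y hy]
    · have := hz' y hy
      rw [h, hzi.2] at this
      rw [h]; linarith
  have hzD : z ∈ V.demand (p + γ • -Pi.single i 1) := by
    refine mem_demand_of_le hxD hzd ?_
    rw [hs, hs, hzi.1, hzi.2]; linarith
  -- Among `0`-`1` vectors, `a` is minimized only at `z`. The multiple of the `i`-th unit vector in
  -- `d` restores the tie of `x` and `z` and shifts all bundles containing `i` equally, so every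
  -- other demanded bundle drops out.
  set a : I → ℝ := fun k => 1 - 2 * z k with ha
  set d : I → ℝ := a + (a ⬝ᵥ x - a ⬝ᵥ z) • Pi.single i 1 with hd
  have hdy : ∀ y, d ⬝ᵥ y = a ⬝ᵥ y + (a ⬝ᵥ x - a ⬝ᵥ z) * y i := fun y => by
    simp [hd, add_dotProduct, smul_dotProduct, single_dotProduct]
  have hay : ∀ y ∈ V.dom, y ≠ z → a ⬝ᵥ z < a ⬝ᵥ y := by
    intro y hy hyz
    obtain ⟨k, hk⟩ := Function.ne_iff.1 hyz
    refine Finset.sum_lt_sum (fun k _ => ?_) ⟨k, Finset.mem_univ _, ?_⟩ <;> simp only [ha] <;>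
      rcases V.dom_binary y hy k with h | h <;> rcases V.dom_binary z hzd k with h' | h' <;>
      simp only [h, h'] at hk ⊢ <;> norm_num <;> simp at hk
  obtain ⟨ε, hε⟩ := (V.eventually_demand_add_smul (p + γ • -Pi.single i 1) d).exists
  have hxz : d ⬝ᵥ x = d ⬝ᵥ z := by
    rw [hdy, hdy, hzi.1, hzi.2]; ring
  have hmin : ∀ y ∈ V.demand (p + γ • -Pi.single i 1), y = x ∨ y = z ∨ d ⬝ᵥ z < d ⬝ᵥ y := by
    intro y hy
    have hyd := demand_subset_dom _ _ hy
    by_cases h1 : y = x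
    · exact Or.inl h1
    by_cases h2 : y = z
    · exact Or.inr (Or.inl h2)
    refine Or.inr (Or.inr ?_)
    rcases V.dom_binary y hyd i with h | h
    · have := surplus_eq_of_mem hy hxD
      rw [hs, hs, h, hzi.1] at this
      have := hstrict y hyd h1
      linarith
    · rw [hdy, hdy, hzi.2, h]
      linarith [hay y hyd h2]
  refine ⟨_, x, hε.trans ?_⟩
  ext y
  simp only [Set.mem_ofPred_eq, Set.mem_insert_iff, Set.mem_singleton_iff]
  constructor
  · rintro ⟨hy, hy'⟩
    rcases hmin y hy with h | h | h
    · exact Or.inl h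
    · exact Or.inr h
    · exact absurd (hy' z hzD) (not_le.2 h)
  · rintro (rfl | rfl)
    · refine ⟨hxD, fun y' hy' => ?_⟩
      rcases hmin y' hy' with h | h | h
      · rw [h]
      · rw [h, hxz]
      · rw [hxz]; exact h.le
    · refine ⟨hzD, fun y' hy' => ?_⟩
      rcases hmin y' hy' with h | h | h
      · rw [h, hxz]
      · rw [h]
      · exact h.le

/-- With `demand_zero_neg_one`, this provides filler agents of known demand, whose endowments can
adjust the total supply. -/
lemma demand_zero_of_pos {p : I → ℝ} (hp : ∀ i, 0 < p i) : (zero I).demand p = {0} := by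
  have h0 : (0 : I → ℝ) ∈ (zero I).dom := fun _ => Or.inl rfl
  ext x
  rw [mem_demand, Set.mem_singleton_iff]
  constructor
  · rintro ⟨hx, h⟩
    have h1 := h 0 h0
    rw [surplus_zero h0, surplus_zero hx, dotProduct_zero, neg_zero, Left.nonneg_neg_iff] at h1
    by_contra hne
    obtain ⟨i, hi⟩ := Function.ne_iff.1 hne
    have hnn : ∀ k, 0 ≤ x k := fun k => by rcases hx k with h | h <;> simp [h]
    have : 0 < p ⬝ᵥ x := Finset.sum_pos' (fun k _ => mul_nonneg (hp k).le (hnn k))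
      ⟨i, Finset.mem_univ _, mul_pos (hp i) (lt_of_le_of_ne (hnn i) (Ne.symm hi))⟩
    linarith
  · rintro rfl
    refine ⟨h0, fun y hy => ?_⟩
    rw [surplus_zero h0, surplus_zero hy, dotProduct_zero, neg_zero, neg_nonpos]
    refine Finset.sum_nonneg fun k _ => mul_nonneg (hp k).le ?_
    rcases hy k with h | h <;> simp [h]

lemma demand_zero_neg_one : (zero I).demand (-1) = {1} := by
  have h0 : (1 : I → ℝ) ∈ (zero I).dom := fun _ => Or.inr rfl
  have hle : ∀ x ∈ (zero I).dom, ∀ k, x k ≤ 1 := fun x hx k => by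
    rcases hx k with h | h <;> simp [h]
  ext x
  rw [mem_demand, Set.mem_singleton_iff]
  have hs : ∀ y ∈ (zero I).dom, (zero I).surplus (-1) y = ∑ i, y i := fun y hy => by
    rw [surplus_zero hy, neg_dotProduct, neg_neg, one_dotProduct]
  constructor
  · rintro ⟨hx, h⟩
    have h1 := h 1 h0
    rw [hs _ h0, hs _ hx] at h1
    have := (Finset.sum_eq_sum_iff_of_le fun k _ => hle x hx k).1
      (le_antisymm (Finset.sum_le_sum fun k _ => hle x hx k) h1)
    exact funext fun k => this k (Finset.mem_univ _)
  · rintro rfl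
    refine ⟨h0, fun y hy => ?_⟩
    rw [hs _ h0, hs _ hy]
    exact Finset.sum_le_sum fun k _ => hle y hy k

lemma demand_zero_one_sub_single [DecidableEq I] (i : I) :
    (zero I).demand (1 - Pi.single i 1) = {0, Pi.single i 1} := by
  have h0 : (0 : I → ℝ) ∈ (zero I).dom := fun _ => Or.inl rfl
  have h1 : (Pi.single i 1 : I → ℝ) ∈ (zero I).dom := fun k => by
    by_cases hk : k = i
    · subst hk; simp
    · simp [hk]
  have hnn : ∀ y ∈ (zero I).dom, ∀ k, 0 ≤ (1 - Pi.single i 1 : I → ℝ) k * y k := fun y hy k => by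
    by_cases hk : k = i
    · subst hk; simp
    · rcases hy k with h | h <;> simp [hk, h]
  have hd1 : (1 - Pi.single i 1 : I → ℝ) ⬝ᵥ Pi.single i 1 = 0 := by simp
  ext x
  rw [mem_demand, Set.mem_insert_iff, Set.mem_singleton_iff]
  constructor
  · rintro ⟨hx, h⟩
    have h2 := h 0 h0
    rw [surplus_zero h0, surplus_zero hx, dotProduct_zero, neg_zero, Left.nonneg_neg_iff] at h2
    have h3 := (Finset.sum_eq_zero_iff_of_nonneg fun k _ => hnn x hx k).1
      (le_antisymm h2 (Finset.sum_nonneg fun k _ => hnn x hx k))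
    have h4 : ∀ k, k ≠ i → x k = 0 := fun k hk => by
      simpa [hk] using h3 k (Finset.mem_univ _)
    rcases hx i with h | h
    · refine Or.inl (funext fun k => ?_)
      by_cases hk : k = i
      · rw [hk, h]; rfl
      · rw [h4 k hk]; rfl
    · refine Or.inr (funext fun k => ?_)
      by_cases hk : k = i
      · subst hk; simpa using h
      · simp [h4 k hk, hk]
  · intro h
    have hx : x ∈ (zero I).dom ∧ (1 - Pi.single i 1 : I → ℝ) ⬝ᵥ x = 0 := by
      rcases h with rfl | rfl
      · exact ⟨h0, dotProduct_zero _⟩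
      · exact ⟨h1, hd1⟩
    refine ⟨hx.1, fun y hy => ?_⟩
    rw [surplus_zero hx.1, surplus_zero hy, hx.2, neg_zero, neg_nonpos]
    exact Finset.sum_nonneg fun k _ => hnn y hy k

end SingleUnitValuation

open SingleUnitValuation

/-! ### Rounding by means of equilibria. -/

section

variable {I : Type*}

/-- A vector is integral if all its entries are integers. -/
def IsIntegralVector (x : I → ℝ) : Prop := ∀ i, ∃ n : ℤ, x i = n

lemma IsIntegralVector.sub {x y : I → ℝ} (hx : IsIntegralVector x) (hy : IsIntegralVector y) :
    IsIntegralVector (x - y) := fun i => by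
  obtain ⟨m, hm⟩ := hx i
  obtain ⟨n, hn⟩ := hy i
  exact ⟨m - n, by simp [hm, hn]⟩

lemma IsBundling.isIntegralVector_bundleVector {B : Finset (I → ℝ)} (hB : IsBundling B) {q : B → ℝ}
    (hq : ∀ b, ∃ n : ℤ, q b = n) : IsIntegralVector (bundleVector B q) := fun i => by
  have : ∀ b : B, ∃ m : ℤ, (b : I → ℝ) i = m := fun b => by
    rcases hB.entries b b.2 i with h | h | h
    · exact ⟨-1, by simp [h]⟩
    · exact ⟨0, by simp [h]⟩
    · exact ⟨1, by simp [h]⟩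
  choose m hm using this
  choose n hn using hq
  exact ⟨∑ b, n b * m b, by simp [bundleVector, Finset.sum_apply, hm, hn]⟩

variable [Fintype I]

/-- A relevant bundle is the difference between the two bundles of a two-element demand set. -/
lemma IsRelevant.exists_demand_eq_pair [DecidableEq I] {𝒱 : Set (SingleUnitValuation I)}
    (h𝒱 : IsInvariantDomain 𝒱) {b : I → ℝ} (hb : IsRelevant 𝒱 b) :
    ∃ V ∈ 𝒱, ∃ p x, V.demand p = {x, x + b} := by
  rcases hb.2 with ⟨V, hV, i, h⟩ | ⟨i, rfl⟩
  · exact ⟨V, hV, h.exists_demand_eq_pair⟩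
  · exact ⟨_, h𝒱.zero_mem, _, 0, by rw [zero_add]; exact demand_zero_one_sub_single i⟩

/-- Every economy with valuations in `𝒱` has a competitive equilibrium. -/
def HasEquilibria (𝒱 : Set (SingleUnitValuation I)) : Prop :=
  ∀ (J : Type) [Fintype J] (E : Economy I J), (∀ j, E.valuation j ∈ 𝒱) →
    ∃ (p : I → ℝ) (x : (j : J) → (E.valuation j).dom), E.IsEquilibrium p x

/-- If a total endowment is a sum of convex combinations of bundles demanded at `p`, then it is a
sum of bundles demanded at `p`. -/
lemma HasEquilibria.exists_demand_sum_eq {𝒱 : Set (SingleUnitValuation I)} (hE : HasEquilibria 𝒱)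
    {J : Type} [Fintype J] (V : J → SingleUnitValuation I) (hV : ∀ j, V j ∈ 𝒱) (p : I → ℝ)
    (y : J → I → ℝ) (hy : ∀ j, y j ∈ convexHull ℝ ((V j).demand p)) (w : ∀ j, (V j).dom)
    (hw : ∑ j, y j = ∑ j, (w j : I → ℝ)) :
    ∃ x : J → I → ℝ, (∀ j, x j ∈ (V j).demand p) ∧ ∑ j, x j = ∑ j, y j := by
  obtain ⟨p', x, hopt, hclear⟩ := hE J ⟨V, fun _ => 0, w⟩ hV
  simp only at x hopt hclear
  refine ⟨fun j => x j, ?_, hclear.trans hw.symm⟩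
  have hext : ∀ (j) (z : (V j).dom), (V j).val z = (V j).extend z := fun j z =>
    ((V j).extend_of_mem z.2).symm
  choose z hz using fun j => (V j).demand_nonempty p
  -- Optimality at the equilibrium prices `p'` bounds a linear functional on the demand set at `p`;
  -- the bound therefore extends to the convex hull.
  have h1 : ∀ j, ∀ v ∈ (V j).demand p,
      (p - p') ⬝ᵥ v ≤ (V j).surplus p' (x j) - (V j).surplus p (z j) := by
    intro j v hv
    have h := hopt j ⟨v, demand_subset_dom _ _ hv⟩
    simp only [utility, hext, dotProduct_sub] at h
    rw [surplus_eq_of_mem (hz j) hv]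
    simp only [surplus, sub_dotProduct]
    linarith
  have h2 : ∀ j, (p - p') ⬝ᵥ y j ≤ (V j).surplus p' (x j) - (V j).surplus p (z j) := by
    intro j
    have hlin : IsLinearMap ℝ fun v : I → ℝ => (p - p') ⬝ᵥ v :=
      ⟨fun a b => dotProduct_add _ _ _, fun c a => dotProduct_smul _ _ _⟩
    exact convexHull_min (fun v hv => h1 j v hv) (convex_halfSpace_le hlin _) (hy j)
  have h3 : ∀ j, (V j).surplus p (x j) ≤ (V j).surplus p (z j) := fun j =>
    (mem_demand.1 (hz j)).2 _ (x j).2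
  -- Market clearing makes the equilibrium allocation attain the maximal total surplus at `p`, so no
  -- single agent can fall short of the maximum.
  have h4 : ∑ j, (V j).surplus p (x j) = ∑ j, (V j).surplus p (z j) := by
    refine le_antisymm (Finset.sum_le_sum fun j _ => h3 j) ?_
    have h5 := Finset.sum_le_sum fun j (_ : j ∈ Finset.univ) => h2 j
    rw [← dotProduct_sum, hw, ← hclear, dotProduct_sum, Finset.sum_sub_distrib] at h5
    have h6 : ∑ j, (V j).surplus p (x j) =
        ∑ j, (V j).surplus p' (x j) - ∑ j, (p - p') ⬝ᵥ (x j : I → ℝ) := by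
      rw [← Finset.sum_sub_distrib]
      refine Finset.sum_congr rfl fun j _ => ?_
      simp only [surplus, sub_dotProduct]; ring
    linarith
  intro j
  have h5 := (Finset.sum_eq_sum_iff_of_le fun j _ => h3 j).1 h4 j (Finset.mem_univ _)
  exact mem_demand_of_le (hz j) (x j).2 h5.ge

/-- If a sum of convex combinations of demanded bundles, at prices that may differ across agents, is
integral, then it is a sum of demanded bundles. -/
lemma HasEquilibria.exists_demand_sum_eq_of_integral {𝒱 : Set (SingleUnitValuation I)}
    (hE : HasEquilibria 𝒱) (h𝒱 : IsInvariantDomain 𝒱) {J : Type*} [Fintype J]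
    (V : J → SingleUnitValuation I) (hV : ∀ j, V j ∈ 𝒱) (p : J → I → ℝ)
    (y : J → I → ℝ) (hy : ∀ j, y j ∈ convexHull ℝ ((V j).demand (p j)))
    (hint : ∀ i, ∃ n : ℤ, (∑ j, y j) i = n) :
    ∃ x : J → I → ℝ, (∀ j, x j ∈ (V j).demand (p j)) ∧ ∑ j, x j = ∑ j, y j := by
  set e := Fintype.equivFin J
  -- A common price vector above every `p j`, so that the shifts `P - p j` are nonnegative as the
  -- invariant domain requires.
  set P : I → ℝ := fun i => 1 + ∑ j, |p j i| with hP
  have hPpos : ∀ i, 0 < P i := fun i => by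
    have := Finset.sum_nonneg fun j (_ : j ∈ Finset.univ) => abs_nonneg (p j i)
    simp only [hP]; linarith
  have hPle : ∀ j i, 0 ≤ (P - p j) i := fun j i => by
    have := Finset.single_le_sum (fun j _ => abs_nonneg (p j i)) (Finset.mem_univ j)
    have := le_abs_self (p j i)
    simp only [hP, Pi.sub_apply]; linarith
  choose x₀ hx₀ using fun j => (V j).demand_nonempty (p j)
  have hd : ∀ i, ∃ n : ℤ, (∑ j, y j) i - (∑ j, x₀ j) i = n := by
    intro i
    obtain ⟨n, hn⟩ := hint i
    have : ∀ j, ∃ m : ℤ, x₀ j i = m := fun j => by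
      rcases (V j).dom_binary _ (demand_subset_dom _ _ (hx₀ j)) i with h | h
      · exact ⟨0, by simp [h]⟩
      · exact ⟨1, by simp [h]⟩
    choose m hm using this
    exact ⟨n - ∑ j, m j, by simp [hn, Finset.sum_apply, hm]⟩
  choose d hd using hd
  set N : ℕ := ∑ i, (d i).natAbs with hN
  have hdN : ∀ i, (d i).natAbs ≤ N := fun i =>
    Finset.single_le_sum (f := fun i => (d i).natAbs) (fun _ _ => Nat.zero_le _) (Finset.mem_univ i)
  -- At `P`, the first `N` fillers demand `0`, and the last `N`, whose effective price is `-1`,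
  -- demand `1`.
  let W : Fin (Fintype.card J) ⊕ (Fin N ⊕ Fin N) → SingleUnitValuation I :=
    Sum.elim (fun j => (V (e.symm j)).addLinear (P - p (e.symm j)))
      (Sum.elim (fun _ => zero I) fun _ => (zero I).addLinear (P + 1))
  have hW0 : ∀ j, (W (Sum.inl j)).demand P = (V (e.symm j)).demand (p (e.symm j)) := fun j => by
    simp only [W, Sum.elim_inl, demand_addLinear, sub_sub_cancel]
  have hW1 : ∀ k, (W (Sum.inr (Sum.inl k))).demand P = {0} := fun k => by
    simpa only [W, Sum.elim_inl, Sum.elim_inr] using demand_zero_of_pos hPpos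
  have hW2 : ∀ k, (W (Sum.inr (Sum.inr k))).demand P = {1} := fun k => by
    simp only [W, Sum.elim_inr, demand_addLinear]
    rw [show P - (P + 1) = -1 by abel]
    exact demand_zero_neg_one
  have hW : ∀ k, W k ∈ 𝒱 := by
    rintro (j | k | k)
    · exact h𝒱.addLinear_mem _ (hV _) _ (hPle _)
    · exact h𝒱.zero_mem
    · exact h𝒱.addLinear_mem _ h𝒱.zero_mem _ fun i => by
        have := hPpos i
        simp only [Pi.add_apply, Pi.one_apply]; linarith
  let Y : Fin (Fintype.card J) ⊕ (Fin N ⊕ Fin N) → I → ℝ :=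
    Sum.elim (fun j => y (e.symm j)) (Sum.elim (fun _ => 0) fun _ => 1)
  have hY : ∀ k, Y k ∈ convexHull ℝ ((W k).demand P) := by
    rintro (j | k | k)
    · rw [hW0]; exact hy _
    · rw [hW1]; exact subset_convexHull ℝ _ rfl
    · rw [hW2]; exact subset_convexHull ℝ _ rfl
  -- Fillers of the first kind bring the positive part of `d`, and those of the second kind lack its
  -- negative part, so supply changes by `d` relative to endowing every filler with its demand.
  let w : ∀ k, (W k).dom := fun k => match k with
    | Sum.inl j => ⟨x₀ (e.symm j), demand_subset_dom (V (e.symm j)) _ (hx₀ (e.symm j))⟩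
    | Sum.inr (Sum.inl k) => ⟨fun i => if (k : ℤ) < d i then 1 else 0, fun i => by
        by_cases h : (k : ℤ) < d i <;> simp [h]⟩
    | Sum.inr (Sum.inr k) => ⟨fun i => if (k : ℤ) < -d i then 0 else 1, fun i => by
        by_cases h : (k : ℤ) < -d i <;> simp [h]⟩
  have hcount : ∀ z : ℤ, z.natAbs ≤ N →
      ∑ k : Fin N, (if ((k : ℕ) : ℤ) < z then (1 : ℝ) else 0) = (z.toNat : ℝ) := by
    intro z hz
    rw [Fin.sum_univ_eq_sum_range (fun k => if (k : ℤ) < z then (1 : ℝ) else 0) N,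
      Finset.sum_boole]
    congr 1
    rw [show (Finset.range N).filter (fun k : ℕ => (k : ℤ) < z) = Finset.range z.toNat by
      ext k; simp only [Finset.mem_filter, Finset.mem_range]; omega, Finset.card_range]
  have hsum : ∑ k, Y k = ∑ k, (w k : I → ℝ) := by
    ext i
    rw [Fintype.sum_sum_type, Fintype.sum_sum_type, Fintype.sum_sum_type, Fintype.sum_sum_type]
    simp only [Y, w, Sum.elim_inl, Sum.elim_inr]
    rw [Equiv.sum_comp e.symm y, Equiv.sum_comp e.symm x₀]
    have h1 := hcount (d i) (hdN i)
    have h2 := hcount (-d i) (by simpa using hdN i)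
    have h3 : ∀ k : Fin N, (if ((k : ℕ) : ℤ) < -d i then (0 : ℝ) else 1) =
        1 - if ((k : ℕ) : ℤ) < -d i then (1 : ℝ) else 0 := fun k => by split_ifs <;> simp
    have h4 : ((d i).toNat : ℝ) - ((-d i).toNat : ℝ) = d i := by
      exact_mod_cast Int.toNat_sub_toNat_neg (d i)
    have h5 := hd i
    simp only [Pi.add_apply, Finset.sum_apply, h3, h1, Finset.sum_sub_distrib, h2,
      Pi.zero_apply, Pi.one_apply] at h5 ⊢
    simp only [Finset.sum_const_zero]
    linarith
  obtain ⟨X, hX, hXsum⟩ := hE.exists_demand_sum_eq W hW P Y hY w hsum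
  refine ⟨fun j => X (Sum.inl (e j)), fun j => ?_, ?_⟩
  · have := hX (Sum.inl (e j))
    rwa [hW0, e.symm_apply_apply] at this
  · have h1 : ∀ k, X (Sum.inr (Sum.inl k)) = 0 := fun k => by
      have := hX (Sum.inr (Sum.inl k)); rwa [hW1] at this
    have h2 : ∀ k, X (Sum.inr (Sum.inr k)) = 1 := fun k => by
      have := hX (Sum.inr (Sum.inr k)); rwa [hW2] at this
    rw [Fintype.sum_sum_type, Fintype.sum_sum_type, Fintype.sum_sum_type,
      Fintype.sum_sum_type] at hXsum
    simp only [Y, h1, h2, Sum.elim_inl, Sum.elim_inr, add_left_inj] at hXsum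
    rw [Equiv.sum_comp e.symm y] at hXsum
    rw [← hXsum]
    exact Equiv.sum_comp e fun j => X (Sum.inl j)

/-- In a sum of convex combinations of demanded bundles and of fractions of relevant bundles that is
integral, the summands can be replaced by demanded bundles and by zero or one units of the relevant
bundles. -/
lemma HasEquilibria.exists_rounding [DecidableEq I] {𝒱 : Set (SingleUnitValuation I)}
    (hE : HasEquilibria 𝒱) (h𝒱 : IsInvariantDomain 𝒱) {J T : Type*} [Fintype J] [Fintype T]
    (V : J → SingleUnitValuation I) (hV : ∀ j, V j ∈ 𝒱) (p : J → I → ℝ)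
    (y : J → I → ℝ) (hy : ∀ j, y j ∈ convexHull ℝ ((V j).demand (p j)))
    (b : T → I → ℝ) (hb : ∀ e, IsRelevant 𝒱 (b e)) (f : T → ℝ) (hf : ∀ e, f e ∈ Set.Icc (0 : ℝ) 1)
    (hint : ∀ i, ∃ n : ℤ, (∑ j, y j + ∑ e, f e • b e) i = n) :
    ∃ (x : J → I → ℝ) (ε : T → ℝ), (∀ j, x j ∈ (V j).demand (p j)) ∧ (∀ e, ε e = 0 ∨ ε e = 1) ∧
      ∑ j, x j + ∑ e, ε e • b e = ∑ j, y j + ∑ e, f e • b e := by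
  -- Each relevant bundle becomes an agent with demand `{a e, a e + b e}`; the fraction `f e` is a
  -- point of its segment.
  choose W hW r a hWa using fun e => (hb e).exists_demand_eq_pair h𝒱
  have hai : ∀ i, ∃ n : ℤ, (∑ e, a e) i = n := by
    intro i
    have : ∀ e, ∃ m : ℤ, a e i = m := fun e => by
      have hm : a e ∈ (W e).demand (r e) := by rw [hWa]; exact Or.inl rfl
      rcases (W e).dom_binary _ (demand_subset_dom _ _ hm) i with h | h
      · exact ⟨0, by simp [h]⟩
      · exact ⟨1, by simp [h]⟩
    choose m hm using this
    exact ⟨∑ e, m e, by simp [Finset.sum_apply, hm]⟩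
  have hsplit : ∑ k, Sum.elim y (fun e => a e + f e • b e) k =
      (∑ j, y j + ∑ e, f e • b e) + ∑ e, a e := by
    rw [Fintype.sum_sum_type]
    simp only [Sum.elim_inl, Sum.elim_inr, Finset.sum_add_distrib]
    abel
  obtain ⟨X, hX, hXsum⟩ := hE.exists_demand_sum_eq_of_integral h𝒱 (Sum.elim V W)
    (by rintro (j | e); exacts [hV j, hW e]) (Sum.elim p r)
    (Sum.elim y fun e => a e + f e • b e)
    (by
      rintro (j | e)
      · exact hy j
      · simp only [Sum.elim_inr]
        rw [hWa, convexHull_pair, segment_eq_image']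
        exact ⟨f e, hf e, by simp⟩)
    (by
      intro i
      obtain ⟨n, hn⟩ := hint i
      obtain ⟨m, hm⟩ := hai i
      exact ⟨n + m, by rw [hsplit, Pi.add_apply, hn, hm]; push_cast; rfl⟩)
  have hXe : ∀ e, ∃ ε : ℝ, (ε = 0 ∨ ε = 1) ∧ X (Sum.inr e) = a e + ε • b e := by
    intro e
    have h := hX (Sum.inr e)
    simp only [Sum.elim_inr] at h
    rw [hWa] at h
    rcases h with h | h
    · exact ⟨0, Or.inl rfl, by rw [h]; simp⟩
    · exact ⟨1, Or.inr rfl, by rw [Set.mem_singleton_iff.1 h]; simp⟩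
  choose ε hε hXε using hXe
  refine ⟨fun j => X (Sum.inl j), ε, fun j => hX (Sum.inl j), hε, ?_⟩
  rw [hsplit, Fintype.sum_sum_type] at hXsum
  simp only [hXε, Finset.sum_add_distrib] at hXsum
  apply add_right_cancel (b := ∑ e, a e)
  rw [← hXsum]
  abel

lemma SingleUnitValuation.isIntegralVector_of_mem_demand {V : SingleUnitValuation I} {p x : I → ℝ}
    (hx : x ∈ V.demand p) : IsIntegralVector x := fun i => by
  rcases V.dom_binary _ (demand_subset_dom _ _ hx) i with h | h
  · exact ⟨0, by simp [h]⟩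
  · exact ⟨1, by simp [h]⟩

/-! ### Coordinates and prices with respect to a bundling. -/

/-- `φ b` represents the `b`-coordinate with respect to the bundling `B`. -/
structure IsDualSystem (B : Finset (I → ℝ)) (φ : B → I → ℝ) : Prop where
  dot_bundleVector : ∀ q b, φ b ⬝ᵥ bundleVector B q = q b
  bundleVector_dot : ∀ x, bundleVector B (fun b => φ b ⬝ᵥ x) = x

lemma IsBundling.exists_isDualSystem {B : Finset (I → ℝ)} (hB : IsBundling B) :
    ∃ φ, IsDualSystem B φ := by
  classical
  let β : Module.Basis B ℝ (I → ℝ) := Module.Basis.mk hB.linearIndependent (by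
    rw [Subtype.range_coe_subtype]; exact hB.span_eq_top.ge)
  have hβ : ∀ b, β b = (b : I → ℝ) := fun b => by simp [β]
  have hdot : ∀ b x, (fun i => β.coord b (Pi.single i 1)) ⬝ᵥ x = β.coord b x := by
    intro b x
    conv_rhs => rw [pi_eq_sum_univ' x, map_sum]
    refine Finset.sum_congr rfl fun i _ => ?_
    rw [map_smul, smul_eq_mul, mul_comm]
  refine ⟨fun b i => β.coord b (Pi.single i 1), fun q b => ?_, fun x => ?_⟩
  · rw [hdot]
    have : bundleVector B q = ∑ b, q b • β b := by simp [bundleVector, hβ]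
    rw [this, Module.Basis.coord_apply, β.repr_sum_self]
  · conv_rhs => rw [← β.sum_repr x]
    exact Finset.sum_congr rfl fun b _ =>
      congrArg₂ (· • ·) (hdot b x) (hβ b).symm

namespace IsDualSystem

variable {B : Finset (I → ℝ)} {φ : B → I → ℝ}

lemma dot_self (h : IsDualSystem B φ) (b : B) : φ b ⬝ᵥ (b : I → ℝ) = 1 := by
  classical
  have := h.dot_bundleVector (Pi.single b 1) b
  simpa [bundleVector, Pi.single_apply] using this

lemma dot_of_ne (h : IsDualSystem B φ) {b c : B} (hbc : b ≠ c) : φ b ⬝ᵥ (c : I → ℝ) = 0 := by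
  classical
  have := h.dot_bundleVector (Pi.single c 1) b
  simpa [bundleVector, Pi.single_apply, hbc] using this

lemma price_dot_bundleVector (h : IsDualSystem B φ) (t q : B → ℝ) :
    (∑ b, t b • φ b) ⬝ᵥ bundleVector B q = t ⬝ᵥ q := by
  simp only [sum_dotProduct, smul_dotProduct, h.dot_bundleVector, smul_eq_mul]
  rfl

lemma mem_bundledDemand (h : IsDualSystem B φ) {V : SingleUnitValuation I} {t q : B → ℝ} :
    q ∈ V.bundledDemand B t ↔ bundleVector B q ∈ V.demand (∑ b, t b • φ b) := by
  refine exists_congr fun hq => ⟨fun H y hy => ?_, fun H r hr => ?_⟩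
  · obtain ⟨r, rfl⟩ : ∃ r, bundleVector B r = y := ⟨_, h.bundleVector_dot y⟩
    simpa only [h.price_dot_bundleVector] using H r hy
  · simpa only [h.price_dot_bundleVector] using H _ hr

/-- Puts a fall in a bundle price into the directional form that `exists_demand_line` takes. -/
lemma price_fall (φ : B → I → ℝ) {t t' : B → ℝ} {c : B} (ht : IsPriceFall c t t') :
    ∑ b, t' b • φ b = ∑ b, t b • φ b + (t c - t' c) • -φ c := by
  classical
  have h1 : t' = t - Pi.single c (t c - t' c) := by
    ext k
    by_cases hk : k = c
    · subst hk; simp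
    · simp [hk, ht.2 k hk]
  have h2 : ∀ b, t' b • φ b = t b • φ b - (Pi.single c (t c - t' c) : B → ℝ) b • φ b := fun b => by
    conv_lhs => rw [h1]
    rw [Pi.sub_apply, sub_smul]
  rw [Finset.sum_congr rfl fun b _ => h2 b, Finset.sum_sub_distrib,
    Finset.sum_eq_single (a := c) (f := fun b => (Pi.single c (t c - t' c) : B → ℝ) b • φ b)]
  · simp [sub_eq_add_neg]
  · intro b _ hb; simp [hb]
  · simp

/-! ### Unimodularity and rounding in bundle coordinates. -/

variable [DecidableEq I] {𝒱 : Set (SingleUnitValuation I)}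

/-- If equilibria exist, a bundling of relevant bundles is unimodular. -/
lemma exists_int_dot (h : IsDualSystem B φ) (hB : IsBundling B) (hrel : ∀ b ∈ B, IsRelevant 𝒱 b)
    (hE : HasEquilibria 𝒱) (h𝒱 : IsInvariantDomain 𝒱) {x : I → ℝ} (hx : IsIntegralVector x)
    (b : B) : ∃ n : ℤ, φ b ⬝ᵥ x = n := by
  -- The fractional parts also combine to an integral vector. Rounding gives `0`-`1` coefficients
  -- with the same sum, hence the same coefficients; being below one, they vanish.
  set f : B → ℝ := fun e => Int.fract (φ e ⬝ᵥ x) with hf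
  have hfx : bundleVector B f = x - bundleVector B fun e => (⌊φ e ⬝ᵥ x⌋ : ℝ) := by
    rw [eq_sub_iff_add_eq]
    conv_rhs => rw [← h.bundleVector_dot x]
    simp only [bundleVector, ← Finset.sum_add_distrib, ← add_smul, hf, Int.fract_add_floor]
  have hint : IsIntegralVector (bundleVector B f) := by
    rw [hfx]
    exact hx.sub (hB.isIntegralVector_bundleVector fun b => ⟨_, rfl⟩)
  obtain ⟨_, ε, -, hε, hsum⟩ := hE.exists_rounding h𝒱 (J := Empty) (T := B)
    Empty.elim (fun j => j.elim) Empty.elim Empty.elim (fun j => j.elim) (fun e => (e : I → ℝ))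
    (fun e => hrel e e.2) f (fun e => ⟨Int.fract_nonneg _, (Int.fract_lt_one _).le⟩)
    (by rw [Finset.univ_eq_empty, Finset.sum_empty, zero_add]; exact hint)
  simp only [Finset.univ_eq_empty, Finset.sum_empty, zero_add] at hsum
  have hεf : ε b = f b := by
    rw [← h.dot_bundleVector ε b, ← h.dot_bundleVector f b]
    exact congrArg (φ b ⬝ᵥ ·) hsum
  have hlt : f b < 1 := Int.fract_lt_one _
  have h0 : f b = 0 := by
    rcases hε b with h' | h' <;> rw [hεf] at h' <;> linarith
  refine ⟨⌊φ b ⬝ᵥ x⌋, ?_⟩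
  have := Int.floor_add_fract (φ b ⬝ᵥ x)
  simp only [hf] at h0
  rw [h0] at this
  linarith

/-- Rounding a sum of convex combinations of demanded bundles without changing given integral
coordinates. -/
lemma exists_demand_dot_eq (h : IsDualSystem B φ) (hB : IsBundling B)
    (hrel : ∀ b ∈ B, IsRelevant 𝒱 b) (hE : HasEquilibria 𝒱) (h𝒱 : IsInvariantDomain 𝒱)
    {J : Type*} [Fintype J] (V : J → SingleUnitValuation I) (hV : ∀ j, V j ∈ 𝒱) (p : J → I → ℝ)
    (y : J → I → ℝ) (hy : ∀ j, y j ∈ convexHull ℝ ((V j).demand (p j)))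
    (S : Set B) (hS : ∀ b ∈ S, ∃ n : ℤ, φ b ⬝ᵥ ∑ j, y j = n) :
    ∃ x : J → I → ℝ, (∀ j, x j ∈ (V j).demand (p j)) ∧
      ∀ b ∈ S, φ b ⬝ᵥ ∑ j, x j = φ b ⬝ᵥ ∑ j, y j := by
  classical
  -- The fraction of `e` that lifts its coordinate to the next integer; the coordinates in `S` are
  -- untouched.
  let f : {e // e ∉ S} → ℝ := fun e => Int.fract (-(φ e ⬝ᵥ ∑ j, y j))
  have hdot : ∀ (g : {e // e ∉ S} → ℝ), ∀ b ∈ S, φ b ⬝ᵥ ∑ e, g e • (e.1 : I → ℝ) = 0 := by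
    intro g b hb
    rw [dotProduct_sum]
    refine Finset.sum_eq_zero fun e _ => ?_
    rw [dotProduct_smul, h.dot_of_ne (fun hbe : b = e.1 => e.2 (hbe ▸ hb)), smul_zero]
  have hint : IsIntegralVector (∑ j, y j + ∑ e, f e • (e.1 : I → ℝ)) := by
    rw [← h.bundleVector_dot (∑ j, y j + ∑ e, f e • (e.1 : I → ℝ))]
    refine hB.isIntegralVector_bundleVector fun b => ?_
    rw [dotProduct_add]
    by_cases hb : b ∈ S
    · rw [hdot f b hb, add_zero]
      exact hS b hb
    · rw [dotProduct_sum (φ b) _ fun e : {e // e ∉ S} => f e • (e.1 : I → ℝ),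
        Finset.sum_eq_single (⟨b, hb⟩ : {e // e ∉ S})]
      · refine ⟨-⌊-(φ b ⬝ᵥ ∑ j, y j)⌋, ?_⟩
        rw [dotProduct_smul, h.dot_self, smul_eq_mul, mul_one]
        simp only [f, Int.fract]
        push_cast
        ring
      · intro e _ he
        rw [dotProduct_smul, h.dot_of_ne (fun hbe => he (Subtype.ext hbe.symm)), smul_zero]
      · exact fun hn => absurd (Finset.mem_univ _) hn
  obtain ⟨x, ε, hx, -, hsum⟩ := hE.exists_rounding h𝒱 V hV p y hy
    (fun e : {e // e ∉ S} => (e.1 : I → ℝ)) (fun e => hrel e.1 e.1.2) f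
    (fun e => ⟨Int.fract_nonneg _, (Int.fract_lt_one _).le⟩) hint
  refine ⟨x, hx, fun b hb => ?_⟩
  have := congrArg (φ b ⬝ᵥ ·) hsum
  simpa only [dotProduct_add, hdot ε b hb, hdot f b hb, add_zero] using this

/-- The coordinates of the bundles in a demand set have no gaps. -/
lemma exists_demand_dot_succ (h : IsDualSystem B φ) (hB : IsBundling B)
    (hrel : ∀ b ∈ B, IsRelevant 𝒱 b) (hE : HasEquilibria 𝒱) (h𝒱 : IsInvariantDomain 𝒱)
    {V : SingleUnitValuation I} (hV : V ∈ 𝒱) {p u v : I → ℝ} (hu : u ∈ V.demand p)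
    (hv : v ∈ V.demand p) (b : B) {σ : ℤ} (hσ : σ = 1 ∨ σ = -1)
    (huv : σ * (φ b ⬝ᵥ u) < σ * (φ b ⬝ᵥ v)) :
    ∃ w ∈ V.demand p, φ b ⬝ᵥ w = φ b ⬝ᵥ u + σ := by
  obtain ⟨n, hn⟩ := h.exists_int_dot hB hrel hE h𝒱 (isIntegralVector_of_mem_demand hu) b
  obtain ⟨m, hm⟩ := h.exists_int_dot hB hrel hE h𝒱 (isIntegralVector_of_mem_demand hv) b
  have hlt : σ * n < σ * m := by rw [hn, hm] at huv; exact_mod_cast huv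
  have hle : (1 : ℝ) ≤ σ * (φ b ⬝ᵥ v) - σ * (φ b ⬝ᵥ u) := by
    rw [hn, hm]
    have : (1 : ℤ) ≤ σ * m - σ * n := by omega
    exact_mod_cast this
  set k := σ * (φ b ⬝ᵥ v) - σ * (φ b ⬝ᵥ u) with hk
  have hσσ : (σ : ℝ) * σ = 1 := by rcases hσ with rfl | rfl <;> norm_num
  have hdiff : φ b ⬝ᵥ v - φ b ⬝ᵥ u = σ * k := by
    rw [hk]; linear_combination (φ b ⬝ᵥ u - φ b ⬝ᵥ v) * hσσ
  -- The point of the segment exactly one unit from `u` in the `b`-coordinate, to be rounded with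
  -- that coordinate fixed.
  have hval : φ b ⬝ᵥ (u + k⁻¹ • (v - u)) = φ b ⬝ᵥ u + σ := by
    have : k ≠ 0 := by linarith
    rw [dotProduct_add, dotProduct_smul, dotProduct_sub, hdiff, smul_eq_mul]
    field_simp
  obtain ⟨x, hx, hxb⟩ := h.exists_demand_dot_eq hB hrel hE h𝒱 (J := Unit) (fun _ => V)
    (fun _ => hV) (fun _ => p) (fun _ => u + k⁻¹ • (v - u))
    (fun _ => segment_subset_convexHull hu hv (by
      rw [segment_eq_image']
      exact ⟨k⁻¹, ⟨by positivity, inv_le_one_of_one_le₀ hle⟩, rfl⟩)) {b}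
    (by
      rintro _ rfl
      refine ⟨n + σ, ?_⟩
      simp only [Finset.univ_unique, Finset.sum_singleton, hval, hn]
      push_cast
      rfl)
  refine ⟨x (), hx (), ?_⟩
  have := hxb b rfl
  simpa only [Finset.univ_unique, Finset.sum_singleton, hval] using this

/-- If a fall in the price of `c` strictly moves the demand for `b` in the direction `σ`, then some
demand set lies, in the coordinates `b` and `c`, on a line of slope `σ`, and contains two bundles
that differ by one unit. -/
lemma exists_demand_unit_line (h : IsDualSystem B φ) (hB : IsBundling B)
    (hrel : ∀ b ∈ B, IsRelevant 𝒱 b) (hE : HasEquilibria 𝒱) (h𝒱 : IsInvariantDomain 𝒱)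
    {V : SingleUnitValuation I} (hV : V ∈ 𝒱) {b c : B} {t t' q : B → ℝ} {σ : ℤ}
    (hσ : σ = 1 ∨ σ = -1) (hq : q ∈ V.bundledDemand B t) (ht : IsPriceFall c t t')
    (hlt : ∀ q' ∈ V.bundledDemand B t', σ * q b < σ * q' b) :
    ∃ p, ∃ u ∈ V.demand p, ∃ w ∈ V.demand p, φ b ⬝ᵥ w = φ b ⬝ᵥ u + σ ∧ φ c ⬝ᵥ w = φ c ⬝ᵥ u + 1 ∧
      ∀ x ∈ V.demand p, φ c ⬝ᵥ x - φ c ⬝ᵥ u = σ * (φ b ⬝ᵥ x - φ b ⬝ᵥ u) := by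
  have hσσ : (σ : ℝ) * σ = 1 := by rcases hσ with rfl | rfl <;> norm_num
  obtain ⟨p, l, hl, u, hu, v, hv, huv, hline⟩ := V.exists_demand_line (f := (σ : ℝ) • φ b)
    (g := φ c) (sub_pos.2 ht.1) (h.mem_bundledDemand.1 hq) (fun x hx => by
      rw [← price_fall φ ht, ← h.bundleVector_dot x, ← h.mem_bundledDemand] at hx
      have := hlt _ hx
      rwa [smul_dotProduct, smul_dotProduct, h.dot_bundleVector])
  simp only [smul_dotProduct, smul_eq_mul] at huv hline
  obtain ⟨w, hw, hwb⟩ := h.exists_demand_dot_succ hB hrel hE h𝒱 hV hu hv b hσ huv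
  have hint : ∀ x ∈ V.demand p, ∀ e, ∃ n : ℤ, φ e ⬝ᵥ x - φ e ⬝ᵥ u = n := fun x hx e => by
    rw [← dotProduct_sub]
    exact h.exists_int_dot hB hrel hE h𝒱
      ((isIntegralVector_of_mem_demand hx).sub (isIntegralVector_of_mem_demand hu)) e
  have hgw := hline w hw
  rw [hwb, show (σ : ℝ) * (φ b ⬝ᵥ u + σ) - σ * (φ b ⬝ᵥ u) = σ * σ by ring, hσσ, mul_one] at hgw
  -- One unit of `b` changes `c` by `l`, so `l` is an integer; a demanded bundle one unit of `c`
  -- away from `u` shows that `l` divides `1`.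
  have hl1 : l = 1 := by
    obtain ⟨w', hw', hwc⟩ := h.exists_demand_dot_succ hB hrel hE h𝒱 hV hu hw c (σ := 1)
      (Or.inl rfl) (by push_cast; linarith)
    have hgw' := hline w' hw'
    obtain ⟨m, hm⟩ := hint w hw c
    obtain ⟨n, hn⟩ := hint w' hw' b
    have hlm : l = m := by rw [← hgw, hm]
    rw [hwc, ← mul_sub, hn, hlm] at hgw'
    have h1 : m * (σ * n) = 1 := by
      have : (1 : ℝ) = m * (σ * n) := by push_cast at hgw'; linarith
      exact_mod_cast this.symm
    have hmpos : 0 < m := by rw [hlm] at hl; exact_mod_cast hl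
    have := Int.eq_one_of_mul_eq_one_right hmpos.le h1
    rw [hlm, this]; simp
  subst hl1
  refine ⟨p, u, hu, w, hw, hwb, by linarith, fun x hx => ?_⟩
  rw [hline x hx]; ring

end IsDualSystem

end

/-! ### The parity contradiction. -/

theorem theorem2 {I : Type*} [Fintype I] [DecidableEq I]
    (𝒱 : Set (SingleUnitValuation I)) (h𝒱 : IsInvariantDomain 𝒱)
    (hE : ∀ (J : Type) [Fintype J] (E : Economy I J), (∀ j, E.valuation j ∈ 𝒱) →
      ∃ (p : I → ℝ) (x : (j : J) → (E.valuation j).dom), E.IsEquilibrium p x) :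
    BundleConsistent 𝒱 := by
  intro B hB hrel b c
  have hE' : HasEquilibria 𝒱 := hE
  obtain ⟨φ, h⟩ := hB.exists_isDualSystem
  rw [IsConsistent]
  by_contra hcon
  rw [not_or] at hcon
  obtain ⟨hs, hc⟩ := hcon
  simp only [IsSubstitutable, IsComplementary, not_forall, not_exists, not_and, not_le] at hs hc
  obtain ⟨V₁, hV₁, t₁, t₁', q₁, hq₁, ht₁, hlt₁⟩ := hs
  obtain ⟨V₂, hV₂, t₂, t₂', q₂, hq₂, ht₂, hlt₂⟩ := hc
  obtain ⟨p₁, u₁, hu₁, w₁, hw₁, hb₁, hc₁, hl₁⟩ := h.exists_demand_unit_line hB hrel hE' h𝒱 hV₁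
    (b := b) (σ := 1) (Or.inl rfl) (by rw [hq₁]; rfl) ht₁ (fun q' hq' => by simpa using hlt₁ q' hq')
  obtain ⟨p₂, u₂, hu₂, w₂, hw₂, hb₂, hc₂, hl₂⟩ := h.exists_demand_unit_line hB hrel hE' h𝒱 hV₂
    (b := b) (σ := -1) (Or.inr rfl) (by rw [hq₂]; rfl) ht₂ (fun q' hq' => by simpa using hlt₂ q' hq')
  push_cast at hb₁ hb₂ hl₁ hl₂
  have hint : ∀ e, ∀ {V : SingleUnitValuation I} {p x}, x ∈ V.demand p → ∃ n : ℤ, φ e ⬝ᵥ x = n :=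
    fun e _ _ _ hx => h.exists_int_dot hB hrel hE' h𝒱 (isIntegralVector_of_mem_demand hx) e
  have hmid : ∀ {V : SingleUnitValuation I} {p u w}, u ∈ V.demand p → w ∈ V.demand p →
      midpoint ℝ u w ∈ convexHull ℝ (V.demand p) := fun hu hw =>
    segment_subset_convexHull hu hw (midpoint_mem_segment _ _)
  have hdmid : ∀ e u w, φ e ⬝ᵥ midpoint ℝ u w = (φ e ⬝ᵥ u + φ e ⬝ᵥ w) / 2 := fun e u w => by
    rw [midpoint_eq_smul_add, dotProduct_smul, dotProduct_add, invOf_eq_inv, smul_eq_mul]; ring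
  -- The two half-steps cancel in `b` and add up to one unit in `c`.
  have hsumb : φ b ⬝ᵥ ∑ j, ![midpoint ℝ u₁ w₁, midpoint ℝ u₂ w₂] j = φ b ⬝ᵥ u₁ + φ b ⬝ᵥ u₂ := by
    simp only [Fin.sum_univ_two, Matrix.cons_val_zero, Matrix.cons_val_one, dotProduct_add, hdmid]
    linarith
  have hsumc : φ c ⬝ᵥ ∑ j, ![midpoint ℝ u₁ w₁, midpoint ℝ u₂ w₂] j =
      φ c ⬝ᵥ u₁ + φ c ⬝ᵥ u₂ + 1 := by
    simp only [Fin.sum_univ_two, Matrix.cons_val_zero, Matrix.cons_val_one, dotProduct_add, hdmid]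
    linarith
  obtain ⟨x, hx, hxS⟩ := h.exists_demand_dot_eq hB hrel hE' h𝒱 (J := Fin 2) ![V₁, V₂]
    (by rw [Fin.forall_fin_two]; exact ⟨hV₁, hV₂⟩) ![p₁, p₂]
    ![midpoint ℝ u₁ w₁, midpoint ℝ u₂ w₂]
    (by rw [Fin.forall_fin_two]; exact ⟨hmid hu₁ hw₁, hmid hu₂ hw₂⟩) {b, c}
    (by
      rintro e (rfl | rfl)
      · obtain ⟨m, hm⟩ := hint e hu₁
        obtain ⟨n, hn⟩ := hint e hu₂
        exact ⟨m + n, by rw [hsumb, hm, hn]; push_cast; rfl⟩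
      · obtain ⟨m, hm⟩ := hint e hu₁
        obtain ⟨n, hn⟩ := hint e hu₂
        exact ⟨m + n + 1, by rw [hsumc, hm, hn]; push_cast; rfl⟩)
  have hx₁ : x 0 ∈ V₁.demand p₁ := hx 0
  have hx₂ : x 1 ∈ V₂.demand p₂ := hx 1
  have e1 := hxS b (Or.inl rfl)
  have e2 := hxS c (Or.inr rfl)
  rw [hsumb, Fin.sum_univ_two, dotProduct_add] at e1
  rw [hsumc, Fin.sum_univ_two, dotProduct_add] at e2
  have e3 := hl₁ _ hx₁
  have e4 := hl₂ _ hx₂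
  obtain ⟨m, hm⟩ := hint b hx₁
  obtain ⟨n, hn⟩ := hint b hu₁
  -- The changes in `b` are opposite, so by the slopes `1` and `-1` the changes in `c` are equal;
  -- yet they sum to one.
  have e5 : (2 : ℝ) * (m - n) = 1 := by rw [← hm, ← hn]; linarith
  have e6 : 2 * (m - n) = 1 := by exact_mod_cast e5
  omega
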